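/- Let $m\ge 0$. An $m$-variate iterative derivation on a commutative ring $R$ is a ring homomorphism $\theta:R\to R[[T_1,\dots,T_m]]$, $\theta(r)=\sum_{\mathbf k\in\mathbb N^m}\theta^{(\mathbf k)}(r)\mathbf T^{\mathbf k}$, with $\theta^{(\mathbf 0)}=\mathrm{id}_R$ and $\theta^{(\mathbf i)}\circ\theta^{(\mathbf j)}=\binom{\mathbf i+\mathbf j}{\mathbf i}\theta^{(\mathbf i+\mathbf j)}$, where $\binom{\mathbf i+\mathbf j}{\mathbf i}=\prod_\mu\binom{i_\mu+j_\mu}{i_\mu}$. The pair $(R,\theta)$ is called an ID-ring (an ID-field if $R$ is a field), and $C_R=\{r\in R\mid\theta(r)=r\}$ is its ring of constants. An ID-homomorphism is a ring homomorphism that commutes with all $\theta^{(\mathbf k)}$; an ID-extension is an extension whose inclusion is an ID-homomorphism. An ID-ideal of $R$ is an ideal $I$ with $\theta^{(\mathbf k)}(I)\subseteq I$ for all $\mathbf k$, and $R$ is ID-simple if $R\neq 0$ and its only ID-ideals are $0$ and $R$. An iterative differential equation (IDE) over an ID-field $F$ is an equation $\theta(\mathbf y)=A\mathbf y$, where $A=\sum_{\mathbf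 k}A_{\mathbf k}\mathbf T^{\mathbf k}\in\mathrm{GL}_n(F[[\mathbf T]])$ satisfies $A_{\mathbf 0}=1$ and $\binom{\mathbf k+\mathbf l}{\mathbf l}A_{\mathbf k+\mathbf l}=\sum_{\mathbf i+\mathbf j=\mathbf l}\theta^{(\mathbf i)}(A_{\mathbf k})A_{\mathbf j}$ for all $\mathbf k,\mathbf l\in\mathbb N^m$. A PPV-ring (pseudo Picard-Vessiot ring) over $F$ for this IDE is an ID-simple ID-extension $R$ of $F$ with $C_R=C_F$ for which there is a matrix $Y\in\mathrm{GL}_n(R)$ such that $\theta(Y)=AY$ and $R$ is generated as an $F$-algebra by the entries of $Y$ and $\det(Y)^{-1}$. A PPV-extension of $F$ is the quotient field of a PPV-ring over $F$ for some IDE over $F$, with the iterative derivation extending that of the PPV-ring. **Proposition.** Let $F$ be a field with an $m$-variate iterative derivation, let $K=C_F$ be its field of constants, and let $E$ be an ID-extension of $F$ which is a field of finite degree over $F$ and satisfies $C_E=K$. Then there is a finite field extension $L$ of $K$ such that $FL:=F\otimes_K L$, with the iterative derivation $\theta^{(\mathbf k)}(x\otimes l)=\theta^{(\mathbf k)}(x)\otimes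 l$, is a field and $E$ is contained in a PPV-extension $M$ of $FL$, that is, there is an ID-homomorphism $E\to M$ whose restriction to $F$ is the map $F\to FL\subseteq M$. -/

import Mathlib

open scoped TensorProduct

universe u v

/-- The multi-index binomial coefficient `∏ μ, (i μ + j μ choose i μ)`. -/
def multiBinom {m : ℕ} (i j : Fin m →₀ ℕ) : ℕ :=
  ∏ μ : Fin m, (i μ + j μ).choose (i μ)

/-- An `m`-variate iterative derivation on a commutative ring `R`: a ring homomorphism
`θ : R → R[[T₁, …, Tₘ]]`, `θ r = ∑ θ^(i)(r) T^i`, with `θ^(0) = id` and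
`θ^(i) ∘ θ^(j) = (i + j choose i) θ^(i + j)`. -/
structure IterativeDerivation (m : ℕ) (R : Type u) [CommRing R] where
  /-- The underlying ring homomorphism. -/
  toHom : R →+* MvPowerSeries (Fin m) R
  coeff_zero : ∀ r : R, MvPowerSeries.coeff 0 (toHom r) = r
  iterate : ∀ (i j : Fin m →₀ ℕ) (r : R),
    MvPowerSeries.coeff i (toHom (MvPowerSeries.coeff j (toHom r))) =
      multiBinom i j • MvPowerSeries.coeff (i + j) (toHom r)

namespace IterativeDerivation

variable {m : ℕ}

/-- The component map `θ^(k) : R → R`. -/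
noncomputable def comp {R : Type u} [CommRing R] (θ : IterativeDerivation m R) (k : Fin m →₀ ℕ) (r : R) : R :=
  MvPowerSeries.coeff k (θ.toHom r)

/-- The ring of constants `{r | θ r = r}`. -/
noncomputable def constants {R : Type u} [CommRing R] (θ : IterativeDerivation m R) : Subring R :=
  RingHom.eqLocus θ.toHom MvPowerSeries.C

/-- The field of constants of an iterative differential field. -/
noncomputable def constantField {F : Type u} [Field F] (θ : IterativeDerivation m F) : Subfield F :=
  { θ.constants with
    inv_mem' := by
      intro x hx
      change θ.toHom x⁻¹ = MvPowerSeries.C x⁻¹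
      have hx' : θ.toHom x = MvPowerSeries.C x := hx
      rcases eq_or_ne x 0 with rfl | h0
      · simp
      · have h1 : MvPowerSeries.C (σ := Fin m) x * θ.toHom x⁻¹ = 1 := by
          rw [← hx', ← map_mul, mul_inv_cancel₀ h0, map_one]
        have h2 : MvPowerSeries.C (σ := Fin m) x⁻¹ * MvPowerSeries.C x = 1 := by
          rw [← map_mul, inv_mul_cancel₀ h0, map_one]
        calc θ.toHom x⁻¹
            = MvPowerSeries.C (σ := Fin m) x⁻¹ * MvPowerSeries.C x * θ.toHom x⁻¹ := by
              rw [h2, one_mul]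
          _ = MvPowerSeries.C x⁻¹ := by rw [mul_assoc, h1, mul_one] }

/-- A ring homomorphism `f : R → S` is an ID-homomorphism if it commutes with the
iterative derivations, i.e. `θ_S^(k) (f r) = f (θ_R^(k) r)` for all `k` and `r`. -/
def IsIDHom {R : Type u} {S : Type v} [CommRing R] [CommRing S]
    (θR : IterativeDerivation m R) (θS : IterativeDerivation m S) (f : R →+* S) : Prop :=
  ∀ r : R, θS.toHom (f r) = MvPowerSeries.map f (θR.toHom r)

/-- An ID-ideal is an ideal `I` with `θ(I) ⊆ I[[T]]`. -/
def IsIDIdeal {R : Type u} [CommRing R] (θ : IterativeDerivation m R) (I : Ideal R) : Prop :=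
  ∀ r ∈ I, ∀ k : Fin m →₀ ℕ, θ.comp k r ∈ I

/-- `R` is ID-simple if it is nonzero and has no ID-ideals besides `0` and `R`. -/
def IsIDSimple {R : Type u} [CommRing R] (θ : IterativeDerivation m R) : Prop :=
  Nontrivial R ∧ ∀ I : Ideal R, θ.IsIDIdeal I → I = ⊥ ∨ I = ⊤

/-- The iterative derivation of an ID-field `F` with field of constants `K`, as a
homomorphism of `K`-algebras followed by `F → F ⊗ L` on coefficients. -/
noncomputable def leftHom {F : Type u} [Field F] (θ : IterativeDerivation m F)
    (L : Type v) [CommRing L] [Algebra θ.constantField L] :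
    F →ₐ[θ.constantField] MvPowerSeries (Fin m) (F ⊗[θ.constantField] L) :=
  { (MvPowerSeries.map (σ := Fin m)
      (algebraMap F (F ⊗[θ.constantField] L))).comp θ.toHom with
    commutes' := by
      intro c
      have hc : θ.toHom (c : F) = MvPowerSeries.C (c : F) := c.2
      rw [MvPowerSeries.algebraMap_apply]
      change MvPowerSeries.map (algebraMap F (F ⊗[θ.constantField] L)) (θ.toHom (c : F)) =
        MvPowerSeries.C (algebraMap θ.constantField (F ⊗[θ.constantField] L) c)
      rw [hc, MvPowerSeries.map_C]
      rfl }

/-- The trivial iterative derivation on `L`, followed by `L → F ⊗ L` on coefficients. -/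
noncomputable def rightHom {F : Type u} [Field F] (θ : IterativeDerivation m F)
    (L : Type v) [CommRing L] [Algebra θ.constantField L] :
    L →ₐ[θ.constantField] MvPowerSeries (Fin m) (F ⊗[θ.constantField] L) :=
  { (MvPowerSeries.C (σ := Fin m) (R := F ⊗[θ.constantField] L)).comp
      (Algebra.TensorProduct.includeRight (R := θ.constantField) (A := F) (B := L)).toRingHom with
    commutes' := by
      intro c
      rw [MvPowerSeries.algebraMap_apply]
      change MvPowerSeries.C (Algebra.TensorProduct.includeRight (R := θ.constantField) (A := F)
          (B := L) (algebraMap θ.constantField L c)) =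
        MvPowerSeries.C (algebraMap θ.constantField (F ⊗[θ.constantField] L) c)
      rw [AlgHom.commutes] }

/-- The ring homomorphism `F ⊗ L → (F ⊗ L)[[T]]`, `x ⊗ l ↦ ∑ (θ^(k)(x) ⊗ l) T^k`. -/
noncomputable def tensorHom {F : Type u} [Field F] (θ : IterativeDerivation m F)
    (L : Type v) [CommRing L] [Algebra θ.constantField L] :
    F ⊗[θ.constantField] L →ₐ[θ.constantField]
      MvPowerSeries (Fin m) (F ⊗[θ.constantField] L) :=
  Algebra.TensorProduct.lift (θ.leftHom L) (θ.rightHom L) (fun _ _ => Commute.all _ _)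

theorem coeff_tensorHom_tmul {F : Type u} [Field F] (θ : IterativeDerivation m F)
    (L : Type v) [CommRing L] [Algebra θ.constantField L] (k : Fin m →₀ ℕ) (x : F) (l : L) :
    MvPowerSeries.coeff k (θ.tensorHom L (x ⊗ₜ[θ.constantField] l)) =
      θ.comp k x ⊗ₜ[θ.constantField] l := by
  rw [tensorHom, Algebra.TensorProduct.lift_tmul]
  change MvPowerSeries.coeff k
    (MvPowerSeries.map (algebraMap F (F ⊗[θ.constantField] L)) (θ.toHom x) *
      MvPowerSeries.C ((1 : F) ⊗ₜ[θ.constantField] l)) = _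
  rw [MvPowerSeries.coeff_mul_C, MvPowerSeries.coeff_map]
  change (θ.comp k x ⊗ₜ[θ.constantField] (1 : L)) * ((1 : F) ⊗ₜ[θ.constantField] l) = _
  rw [Algebra.TensorProduct.tmul_mul_tmul, mul_one, one_mul]

/-- The iterative derivation on `F ⊗_K L`, where `K` is the field of constants of `F` and `L`
carries the trivial iterative derivation: `θ^(k)(x ⊗ l) = θ^(k)(x) ⊗ l`. -/
noncomputable def baseChange {F : Type u} [Field F] (θ : IterativeDerivation m F)
    (L : Type v) [CommRing L] [Algebra θ.constantField L] :
    IterativeDerivation m (F ⊗[θ.constantField] L) where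
  toHom := (θ.tensorHom L : F ⊗[θ.constantField] L →+*
    MvPowerSeries (Fin m) (F ⊗[θ.constantField] L))
  coeff_zero := by
    intro r
    induction r using TensorProduct.induction_on with
    | zero => simp
    | tmul x l =>
      change MvPowerSeries.coeff 0 (θ.tensorHom L (x ⊗ₜ[θ.constantField] l)) = _
      rw [coeff_tensorHom_tmul, comp, θ.coeff_zero]
    | add a b ha hb => rw [map_add, map_add, ha, hb]
  iterate := by
    intro i j r
    induction r using TensorProduct.induction_on with
    | zero => simp
    | tmul x l =>
      change MvPowerSeries.coeff i (θ.tensorHom L (MvPowerSeries.coeff j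
        (θ.tensorHom L (x ⊗ₜ[θ.constantField] l)))) =
          multiBinom i j • MvPowerSeries.coeff (i + j)
            (θ.tensorHom L (x ⊗ₜ[θ.constantField] l))
      rw [coeff_tensorHom_tmul, coeff_tensorHom_tmul, coeff_tensorHom_tmul]
      unfold comp
      rw [θ.iterate, TensorProduct.smul_tmul']
    | add a b ha hb => rw [map_add, map_add, map_add, map_add, ha, hb, map_add, smul_add]

/-- The matrix `A = ∑ A_k T^k` over `F[[T]]` defines an iterative differential equation
`θ(y) = A y` over `F`: `A ∈ GL_n(F[[T]])`, `A_0 = 1` and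
`(k + l choose l) A_(k+l) = ∑_(i+j=l) θ^(i)(A_k) A_j`.  The base is only asked to be a ring, so
that the notion can be used over a tensor product of fields that happens to be a field. -/
def IsIDE {F : Type u} [CommRing F] (θ : IterativeDerivation m F) {n : ℕ}
    (A : Matrix (Fin n) (Fin n) (MvPowerSeries (Fin m) F)) : Prop :=
  IsUnit A ∧ A.map (MvPowerSeries.coeff 0) = 1 ∧
    ∀ k l : Fin m →₀ ℕ,
      multiBinom l k • A.map (MvPowerSeries.coeff (k + l)) =
        ∑ ij ∈ Finset.HasAntidiagonal.antidiagonal l,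
          (A.map (MvPowerSeries.coeff k)).map (θ.comp ij.1) * A.map (MvPowerSeries.coeff ij.2)

/-- `Y ∈ GL_n(R)` is a fundamental solution matrix of `θ(y) = A y`: `θ(Y) = A Y` in the
`n × n` matrices over `R[[T]]`. -/
def IsFundamentalSolution {F : Type u} {R : Type v} [CommRing F] [CommRing R] [Algebra F R]
    (θR : IterativeDerivation m R) {n : ℕ}
    (A : Matrix (Fin n) (Fin n) (MvPowerSeries (Fin m) F)) (Y : GL (Fin n) R) : Prop :=
  (Y : Matrix (Fin n) (Fin n) R).map θR.toHom =
    A.map (MvPowerSeries.map (algebraMap F R)) *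
      (Y : Matrix (Fin n) (Fin n) R).map MvPowerSeries.C

/-- `(R, θR)` is a pseudo Picard-Vessiot ring over `(F, θF)` for `θ(y) = A y`. -/
structure IsPPVRing {F : Type u} {R : Type v} [CommRing F] [CommRing R] [Algebra F R]
    (θF : IterativeDerivation m F) (θR : IterativeDerivation m R) {n : ℕ}
    (A : Matrix (Fin n) (Fin n) (MvPowerSeries (Fin m) F)) : Prop where
  idExtension : IsIDHom θF θR (algebraMap F R)
  idSimple : θR.IsIDSimple
  generated : ∃ Y : GL (Fin n) R, IsFundamentalSolution θR A Y ∧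
    Algebra.adjoin F
      (Set.range (fun ij : Fin n × Fin n => (Y : Matrix (Fin n) (Fin n) R) ij.1 ij.2) ∪
        {((Matrix.GeneralLinearGroup.det Y)⁻¹ : Rˣ).val}) = ⊤
  constants_eq : θR.constants = θF.constants.map (algebraMap F R)

/-- `(M, θM)` is a pseudo Picard-Vessiot field over `(F, θF)`: the quotient field of a
PPV-ring `R` for some iterative differential equation over `F`, with the iterative derivation
extending that of `R`. -/
def IsPPVField {F : Type u} {M : Type v} [CommRing F] [Field M] [Algebra F M]
    (θF : IterativeDerivation m F) (θM : IterativeDerivation m M) : Prop :=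
  ∃ (n : ℕ) (A : Matrix (Fin n) (Fin n) (MvPowerSeries (Fin m) F)), θF.IsIDE A ∧
    ∃ (R : Type v) (_ : CommRing R) (_ : Algebra F R) (_ : Algebra R M) (_ : IsScalarTower F R M)
      (θR : IterativeDerivation m R),
      IsPPVRing θF θR A ∧ IsFractionRing R M ∧ IsIDHom θR θM (algebraMap R M)

end IterativeDerivation

universe w

namespace IterativeDerivation

open MvPowerSeries Finset.HasAntidiagonal

variable {m : ℕ}

/-! Let `b` be a basis of `E` over `F`. Its coordinates turn the action of `θ` on `E` into an
equation `θ(y) = A y` over `F` with solution `b` (`exists_isIDE_of_basis`). Over `E` this equation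
has an ID-simple solution ring `R`: adjoin a generic invertible matrix with `θ(X) = A X` and divide
by a maximal ID-ideal (`exists_idSimple_generated`). ID-simplicity makes `R` a domain and its
constants a field `L`. The theorem holds for this `L`, with `M` the quotient field of `R`.

Finiteness of `L` over `K`: since `E` has no new constants, `L` and `E` are linearly disjoint over
`K` inside `R`. As `R` is a finitely generated `E`-algebra, Chevalley's theorem makes every element
of `L` algebraic over `E`, so `E[L]` is a field. It embeds into a residue field of `R`, which is
finite over `E`, and a `K`-basis of `L` stays independent there
(`finiteDimensional_of_linearIndependent`).

Disjointness also gives an injection `F ⊗ L → R`, so `F ⊗ L` is a domain finite over `F`, hence a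
field. Finally `b = Y v` with `v` a vector of constants, that is, of elements of `L`. So `E` already
lies in the algebra generated over `FL` by the entries of `Y`, and `R` is a PPV-ring over `FL`
(`isPPVRing_of_basis`). -/

/-! ### Multi-index Vandermonde identity and Taylor expansion. -/

theorem sum_antidiagonal_prod_choose (a b i : Fin m →₀ ℕ) :
    ∑ p ∈ antidiagonal i, (∏ μ, (a μ).choose (p.1 μ)) * ∏ μ, (b μ).choose (p.2 μ) =
      ∏ μ, (a μ + b μ).choose (i μ) := by
  classical
  simp_rw [Nat.add_choose_eq, Finset.prod_univ_sum, ← Finset.prod_mul_distrib]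
  refine Finset.sum_bij' (fun p _ μ => (p.1 μ, p.2 μ))
    (fun q _ => (Finsupp.equivFunOnFinite.symm fun μ => (q μ).1,
      Finsupp.equivFunOnFinite.symm fun μ => (q μ).2)) ?_ ?_ ?_ ?_ ?_
  · intro p hp
    rw [mem_antidiagonal] at hp
    simp [← hp]
  · intro q hq
    rw [mem_antidiagonal]
    ext μ
    simpa using (Fintype.mem_piFinset.1 hq) μ
  · intro p _
    ext <;> simp
  · intro q _
    ext <;> simp
  · intro p _
    rfl

theorem prod_choose_eq_zero {a p : Fin m →₀ ℕ} (h : ¬ p ≤ a) :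
    ∏ μ, (a μ).choose (p μ) = 0 := by
  rw [Finsupp.le_def, not_forall] at h
  obtain ⟨μ, hμ⟩ := h
  exact Finset.prod_eq_zero (Finset.mem_univ μ) (Nat.choose_eq_zero_of_lt (not_le.1 hμ))

/-- This is multiplicativity of the Taylor expansion, coefficient by coefficient. Vandermonde splits
the binomial of `i + j = r.1 + r.2` over the pairs `p` with sum `i`; for fixed `p` only the `r`
above `p` contribute, and `q = r - p` then runs over the pairs with sum `j`. -/
theorem multiBinom_smul_sum_antidiagonal {R : Type*} [AddCommMonoid R] (i j : Fin m →₀ ℕ)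
    (h : (Fin m →₀ ℕ) → (Fin m →₀ ℕ) → R) :
    multiBinom i j • ∑ r ∈ antidiagonal (i + j), h r.1 r.2 =
      ∑ q ∈ antidiagonal j, ∑ p ∈ antidiagonal i,
        (multiBinom p.1 q.1 * multiBinom p.2 q.2) • h (p.1 + q.1) (p.2 + q.2) := by
  classical
  have h1 : ∀ r ∈ antidiagonal (i + j), multiBinom i j • h r.1 r.2 =
      ∑ p ∈ antidiagonal i,
        ((∏ μ, (r.1 μ).choose (p.1 μ)) * ∏ μ, (r.2 μ).choose (p.2 μ)) • h r.1 r.2 := by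
    intro r hr
    rw [mem_antidiagonal] at hr
    rw [← Finset.sum_smul, sum_antidiagonal_prod_choose, multiBinom]
    congr 1
    refine Finset.prod_congr rfl fun μ _ => ?_
    rw [← Finsupp.add_apply, ← Finsupp.add_apply, hr]
  rw [Finset.smul_sum, Finset.sum_congr rfl h1, Finset.sum_comm,
    Finset.sum_comm (s := antidiagonal j)]
  refine Finset.sum_congr rfl fun p hp => ?_
  rw [mem_antidiagonal] at hp
  symm
  refine Finset.sum_of_injOn (fun q => (p.1 + q.1, p.2 + q.2)) ?_ ?_ ?_ ?_
  · rintro ⟨a, b⟩ _ ⟨c, d⟩ _ hab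
    simpa using hab
  · rintro ⟨a, b⟩ hab
    rw [Finset.mem_coe, mem_antidiagonal] at hab ⊢
    rw [← hp, ← hab]
    exact add_add_add_comm _ _ _ _
  · rintro ⟨a, b⟩ hab hn
    rw [mem_antidiagonal] at hab
    by_cases ha : p.1 ≤ a
    · by_cases hb : p.2 ≤ b
      · refine (hn ⟨(a - p.1, b - p.2), ?_, ?_⟩).elim
        · rw [Finset.mem_coe, mem_antidiagonal]
          have : i + ((a - p.1) + (b - p.2)) = i + j := by
            rw [← hab, ← hp, add_add_add_comm, add_tsub_cancel_of_le ha, add_tsub_cancel_of_le hb]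
          exact add_left_cancel this
        · simp [add_tsub_cancel_of_le ha, add_tsub_cancel_of_le hb]
      · rw [prod_choose_eq_zero hb, mul_zero, zero_smul]
    · rw [prod_choose_eq_zero ha, zero_mul, zero_smul]
  · intro q _
    rfl

theorem multiBinom_zero_zero : multiBinom (0 : Fin m →₀ ℕ) 0 = 1 := by
  simp [multiBinom]

/-- The Taylor expansion `f(T + U)` of `f(T)`, with the powers of `U` outside. -/
noncomputable def taylorFun {R : Type*} [CommRing R] (f : MvPowerSeries (Fin m) R) :
    MvPowerSeries (Fin m) (MvPowerSeries (Fin m) R) :=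
  fun j => (fun i => multiBinom i j • coeff (i + j) f : MvPowerSeries (Fin m) R)

theorem coeff_coeff_taylorFun {R : Type*} [CommRing R] (f : MvPowerSeries (Fin m) R)
    (i j : Fin m →₀ ℕ) :
    coeff i (coeff j (taylorFun f)) = multiBinom i j • coeff (i + j) f :=
  rfl

/-- The Taylor homomorphism `f(T) ↦ f(T + U)`. -/
noncomputable def taylor (m : ℕ) (R : Type*) [CommRing R] :
    MvPowerSeries (Fin m) R →+* MvPowerSeries (Fin m) (MvPowerSeries (Fin m) R) where
  toFun := taylorFun
  map_zero' := by
    refine MvPowerSeries.ext fun j => MvPowerSeries.ext fun i => ?_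
    rw [coeff_coeff_taylorFun]
    simp
  map_one' := by
    classical
    refine MvPowerSeries.ext fun j => MvPowerSeries.ext fun i => ?_
    rw [coeff_coeff_taylorFun, coeff_one, coeff_one]
    by_cases hj : j = 0
    · by_cases hi : i = 0
      · simp [hi, hj, multiBinom_zero_zero]
      · simp [hi, hj, coeff_one]
    · simp [hj]
  map_add' f g := by
    refine MvPowerSeries.ext fun j => MvPowerSeries.ext fun i => ?_
    simp only [map_add, coeff_coeff_taylorFun, smul_add]
  map_mul' f g := by
    classical
    refine MvPowerSeries.ext fun j => MvPowerSeries.ext fun i => ?_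
    rw [coeff_coeff_taylorFun, coeff_mul,
      multiBinom_smul_sum_antidiagonal i j fun a b => coeff a f * coeff b g, coeff_mul, map_sum]
    refine Finset.sum_congr rfl fun q _ => ?_
    rw [coeff_mul]
    refine Finset.sum_congr rfl fun p _ => ?_
    rw [coeff_coeff_taylorFun, coeff_coeff_taylorFun, smul_mul_smul_comm]

theorem coeff_coeff_taylor {R : Type*} [CommRing R] (f : MvPowerSeries (Fin m) R)
    (i j : Fin m →₀ ℕ) :
    coeff i (coeff j (taylor m R f)) = multiBinom i j • coeff (i + j) f :=
  rfl

theorem taylor_map {R S : Type*} [CommRing R] [CommRing S] (f : R →+* S)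
    (x : MvPowerSeries (Fin m) R) :
    taylor m S (map f x) = map (map f) (taylor m R x) := by
  ext j i
  simp [coeff_coeff_taylor, coeff_map]

/-- The iteration rule becomes an equality of two ring homomorphisms, which can be checked on
generators; `ofRingHom` is the converse. -/
theorem map_toHom_toHom {R : Type*} [CommRing R] (θ : IterativeDerivation m R) (r : R) :
    map θ.toHom (θ.toHom r) = taylor m R (θ.toHom r) := by
  ext j i
  rw [coeff_map, θ.iterate, coeff_coeff_taylor]

/-- An iterative derivation from a ring homomorphism whose iterates are given by the Taylor
homomorphism. -/
def ofRingHom {R : Type*} [CommRing R] (φ : R →+* MvPowerSeries (Fin m) R)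
    (h0 : (constantCoeff (σ := Fin m) (R := R)).comp φ = RingHom.id R)
    (h : (map φ).comp φ = (taylor m R).comp φ) : IterativeDerivation m R where
  toHom := φ
  coeff_zero r := RingHom.congr_fun h0 r
  iterate i j r := by
    have := congrArg (fun x => coeff i (coeff j x)) (RingHom.congr_fun h r)
    simpa [coeff_map, coeff_coeff_taylor] using this

end IterativeDerivation

/-! ### Commutative algebra: subfields of finitely generated algebras over a field. -/

/-- Over a domain, a finitely generated extension domain has a nonzero element of the base outside
whose zero set every prime lifts. -/
theorem exists_ne_zero_forall_mem_range_comap {A B : Type*} [CommRing A] [IsNoetherianRing A]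
    [CommRing B] [IsDomain B] (f : A →+* B) (hf : f.FiniteType) (hinj : Function.Injective f) :
    ∃ a : A, a ≠ 0 ∧ ∀ q : PrimeSpectrum A, a ∉ q.asIdeal →
      q ∈ Set.range (PrimeSpectrum.comap f) := by
  have hA : IsDomain A := hinj.isDomain f
  have hfp : f.FinitePresentation := RingHom.FinitePresentation.of_finiteType.1 hf
  -- Chevalley: the image is constructible. By injectivity it contains the generic point, and the
  -- piece `C` through that point has only zero equations, so it is the open set where `C.f` does
  -- not vanish.
  obtain ⟨S, hS⟩ := PrimeSpectrum.exists_constructibleSetData_iff.2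
    (PrimeSpectrum.isConstructible_range_comap hfp)
  have hgen : (⟨⊥, Ideal.isPrime_bot⟩ : PrimeSpectrum A) ∈ S.toSet := by
    rw [hS]
    refine ⟨⟨⊥, Ideal.isPrime_bot⟩, PrimeSpectrum.ext ?_⟩
    exact Ideal.comap_bot_of_injective f hinj
  simp only [PrimeSpectrum.ConstructibleSetData.toSet, Set.mem_iUnion] at hgen
  obtain ⟨C, hC, hgen⟩ := hgen
  simp only [PrimeSpectrum.BasicConstructibleSetData.toSet, Set.mem_sdiff,
    PrimeSpectrum.mem_zeroLocus, Set.singleton_subset_iff, SetLike.mem_coe] at hgen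
  refine ⟨C.f, by simpa using hgen.2, fun q hq => ?_⟩
  rw [← hS]
  simp only [PrimeSpectrum.ConstructibleSetData.toSet, Set.mem_iUnion]
  refine ⟨C, hC, ?_⟩
  simp only [PrimeSpectrum.BasicConstructibleSetData.toSet, Set.mem_sdiff,
    PrimeSpectrum.mem_zeroLocus, Set.singleton_subset_iff, SetLike.mem_coe]
  refine ⟨fun x hx => ?_, hq⟩
  have : x = 0 := by simpa using hgen.1 hx
  rw [this]
  exact q.asIdeal.zero_mem

open Polynomial in
/-- An element `c` of a finitely generated domain over `E` is algebraic over `E` if all nonzero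
values at `c` of polynomials over a subfield `K` are units. -/
theorem isAlgebraic_of_forall_isUnit_aeval {K E B : Type*} [Field K] [Field E] [Algebra K E]
    [CommRing B] [IsDomain B] [Algebra E B] [Algebra K B] [IsScalarTower K E B]
    [Algebra.FiniteType E B] (c : B)
    (hc : ∀ p : K[X], aeval c p ≠ 0 → IsUnit (aeval c p)) : IsAlgebraic E c := by
  by_contra htr
  have hinj : Function.Injective (aeval (R := E) c) := transcendental_iff_injective.1 htr
  have hft : (aeval (R := E) c).toRingHom.FiniteType := by
    refine RingHom.FiniteType.of_comp_finiteType (f := algebraMap E E[X]) ?_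
    rw [AlgHom.toRingHom_eq_coe, AlgHom.comp_algebraMap]
    exact RingHom.finiteType_algebraMap.2 inferInstance
  obtain ⟨f, hf0, hf⟩ := exists_ne_zero_forall_mem_range_comap _ hft hinj
  -- `K` may be finite, so the point avoiding the zeros of `f` is sought in its algebraic closure,
  -- which is always infinite.
  let φ : AlgebraicClosure K →ₐ[K] AlgebraicClosure E := IsAlgClosed.lift
  obtain ⟨a, ha⟩ : ∃ a : AlgebraicClosure K, aeval (φ a) f ≠ 0 := by
    by_contra! h
    have hfin := (f.rootSet_finite (AlgebraicClosure E))
    refine (Set.infinite_range_of_injective φ.injective) (hfin.subset ?_)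
    rintro _ ⟨a, rfl⟩
    exact (mem_rootSet_of_ne hf0).2 (h a)
  let ev : E[X] →ₐ[E] AlgebraicClosure E := aeval (φ a)
  obtain ⟨Q, hQ⟩ := hf ⟨RingHom.ker ev.toRingHom, RingHom.ker_isPrime _⟩ ha
  -- The prime `Q` lies over the point `X = φ a`, so it contains `p(c)`. This value is nonzero
  -- because `c` is transcendental, hence a unit by `hc`: a contradiction.
  let p : K[X] := minpoly K a
  have hp0 : p ≠ 0 := minpoly.ne_zero (Algebra.IsIntegral.isIntegral a)
  have hpc : aeval c p = aeval (R := E) c (p.map (algebraMap K E)) := by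
    rw [aeval_map_algebraMap]
  have hmem : aeval c p ∈ Q.asIdeal := by
    have h1 : p.map (algebraMap K E) ∈ RingHom.ker ev.toRingHom := by
      change aeval (φ a) (p.map (algebraMap K E)) = 0
      rw [aeval_map_algebraMap, aeval_algHom_apply, minpoly.aeval, map_zero]
    have h2 := congrArg PrimeSpectrum.asIdeal hQ
    change _ = RingHom.ker ev.toRingHom at h2
    rw [← h2] at h1
    rw [hpc]
    exact h1
  refine Q.2.ne_top (Ideal.eq_top_of_isUnit_mem _ hmem (hc p ?_))
  rw [hpc, Ne, map_eq_zero_iff _ hinj, Polynomial.map_eq_zero]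
  exact hp0

/-- A field `L` inside a finitely generated `E`-domain which is linearly disjoint from `E` over
`K` is finite over `K`. -/
theorem finiteDimensional_of_linearIndependent {K E B : Type*} {L : Type w} [Field K]
    [Field E] [Field L]
    [Algebra K E] [Algebra K L] [CommRing B] [IsDomain B] [Algebra E B] [Algebra K B]
    [IsScalarTower K E B] [Algebra.FiniteType E B] (f : L →ₐ[K] B)
    (hf : ∀ (ι : Type w) (v : ι → L), LinearIndependent K v → LinearIndependent E (f ∘ v)) :
    FiniteDimensional K L := by
  -- Values at `f l` of polynomials over `K` are images of elements of the field `L`, so the nonzero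
  -- ones are units.
  have halg : ∀ l : L, IsIntegral E (f l) := fun l => by
    refine (isAlgebraic_of_forall_isUnit_aeval (K := K) (f l) fun p hp => ?_).isIntegral
    rw [Polynomial.aeval_algHom_apply] at hp ⊢
    refine (IsUnit.mk0 _ fun h => hp ?_).map f
    rw [h, map_zero]
  let S : Subalgebra E B := Algebra.adjoin E (Set.range f)
  have hS : Algebra.IsIntegral E S := by
    rw [← le_integralClosure_iff_isIntegral]
    refine Algebra.adjoin_le ?_
    rintro _ ⟨l, rfl⟩
    exact halg l
  have hSf : IsField S := isField_of_isIntegral_of_isField' (Field.toIsField E)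
  -- By Zariski's lemma `B ⧸ M` is finite over `E`. The field `S` embeds into it, so a `K`-basis of
  -- `L`, independent over `E`, must be finite.
  obtain ⟨M, hM⟩ := Ideal.exists_maximal B
  let _ : Field (B ⧸ M) := Ideal.Quotient.field M
  have hN : Module.Finite E (B ⧸ M) := finite_of_finite_type_of_isJacobsonRing E (B ⧸ M)
  let g : S →ₐ[E] B ⧸ M := (Ideal.Quotient.mkₐ E M).comp S.val
  have hg : Function.Injective g := by
    let _ := hSf.toField
    exact RingHom.injective g.toRingHom
  let b := Module.Basis.ofVectorSpace K L
  have hv := hf _ b b.linearIndependent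
  let w : Module.Basis.ofVectorSpaceIndex K L → S := fun i =>
    ⟨f (b i), Algebra.subset_adjoin ⟨_, rfl⟩⟩
  have hw : LinearIndependent E w := LinearIndependent.of_comp S.val.toLinearMap hv
  have hgw : LinearIndependent E (g.toLinearMap ∘ w) :=
    hw.map' _ (LinearMap.ker_eq_bot.2 hg)
  have : Finite (Module.Basis.ofVectorSpaceIndex K L) := hgw.finite
  exact Module.Finite.of_basis b

namespace IterativeDerivation

open MvPowerSeries Finset.HasAntidiagonal

variable {m : ℕ}

/-! ### Constants, ID-homomorphisms and linear independence. -/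

section Constants

variable {R : Type*} [CommRing R] (θ : IterativeDerivation m R)

theorem comp_zero_index (r : R) : θ.comp 0 r = r :=
  θ.coeff_zero r

theorem comp_comp (i j : Fin m →₀ ℕ) (r : R) :
    θ.comp i (θ.comp j r) = multiBinom i j • θ.comp (i + j) r :=
  θ.iterate i j r

theorem comp_add (k : Fin m →₀ ℕ) (r s : R) : θ.comp k (r + s) = θ.comp k r + θ.comp k s := by
  simp [comp]

theorem comp_map_zero (k : Fin m →₀ ℕ) : θ.comp k (0 : R) = 0 := by
  simp [comp]

theorem comp_sum (k : Fin m →₀ ℕ) {ι : Type*} (s : Finset ι) (f : ι → R) :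
    θ.comp k (∑ i ∈ s, f i) = ∑ i ∈ s, θ.comp k (f i) := by
  simp [comp]

theorem comp_mul (k : Fin m →₀ ℕ) (r s : R) :
    θ.comp k (r * s) = ∑ p ∈ antidiagonal k, θ.comp p.1 r * θ.comp p.2 s := by
  classical
  simp [comp, coeff_mul]

theorem mem_constants {r : R} : r ∈ θ.constants ↔ θ.toHom r = C r :=
  Iff.rfl

theorem mem_constants_iff_comp {r : R} : r ∈ θ.constants ↔ ∀ k, k ≠ 0 → θ.comp k r = 0 := by
  classical
  rw [mem_constants, MvPowerSeries.ext_iff]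
  refine forall_congr' fun k => ?_
  rw [coeff_C]
  by_cases hk : k = 0
  · subst hk
    simpa using θ.coeff_zero r
  · simp [hk, comp]

theorem comp_mul_of_mem_constants (k : Fin m →₀ ℕ) (r : R) {c : R} (hc : c ∈ θ.constants) :
    θ.comp k (r * c) = θ.comp k r * c := by
  rw [comp, map_mul, θ.mem_constants.1 hc, coeff_mul_C, comp]

theorem inv_mem_constants {c d : R} (hc : c ∈ θ.constants) (h : c * d = 1) : d ∈ θ.constants := by
  rw [mem_constants] at hc ⊢
  have h1 : C (σ := Fin m) c * θ.toHom d = 1 := by rw [← hc, ← map_mul, h, map_one]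
  have h2 : C (σ := Fin m) c * C d = 1 := by rw [← map_mul, h, map_one]
  calc θ.toHom d = (C (σ := Fin m) c * C d) * θ.toHom d := by rw [h2, one_mul]
    _ = (C (σ := Fin m) c * θ.toHom d) * C d := by ring
    _ = C d := by rw [h1, one_mul]

end Constants

section Hom

variable {R S T : Type*} [CommRing R] [CommRing S] [CommRing T] {θR : IterativeDerivation m R}
  {θS : IterativeDerivation m S} {θT : IterativeDerivation m T}

theorem isIDHom_iff {f : R →+* S} :
    IsIDHom θR θS f ↔ ∀ k r, θS.comp k (f r) = f (θR.comp k r) := by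
  refine ⟨fun h k r => ?_, fun h r => MvPowerSeries.ext fun k => ?_⟩
  · rw [comp, h r, coeff_map, comp]
  · rw [coeff_map]
    exact h k r

theorem IsIDHom.map_comp {f : R →+* S} (h : IsIDHom θR θS f) (k : Fin m →₀ ℕ) (r : R) :
    θS.comp k (f r) = f (θR.comp k r) :=
  isIDHom_iff.1 h k r

theorem IsIDHom.trans {g : S →+* T} {f : R →+* S} (hg : IsIDHom θS θT g) (hf : IsIDHom θR θS f) :
    IsIDHom θR θT (g.comp f) :=
  isIDHom_iff.2 fun k r => by
    rw [RingHom.comp_apply, hg.map_comp, hf.map_comp, RingHom.comp_apply]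

theorem IsIDHom.map_mem_constants {f : R →+* S} (h : IsIDHom θR θS f) {r : R}
    (hr : r ∈ θR.constants) : f r ∈ θS.constants := by
  rw [mem_constants, h r, θR.mem_constants.1 hr, map_C]

/-- Constants that are linearly independent over the constants of an ID-field `E` are linearly
independent over `E`. -/
theorem linearIndependent_of_constants {E : Type*} [Field E] [Algebra E R]
    {θE : IterativeDerivation m E} (h : IsIDHom θE θR (algebraMap E R)) {ι : Type*} {v : ι → R}
    (hv : ∀ i, v i ∈ θR.constants)
    (hlin : ∀ (s : Finset ι) (g : ι → E), (∀ i ∈ s, g i ∈ θE.constants) →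
      ∑ i ∈ s, algebraMap E R (g i) * v i = 0 → ∀ i ∈ s, g i = 0) :
    LinearIndependent E v := by
  classical
  rw [linearIndependent_iff']
  simp_rw [Algebra.smul_def]
  intro s
  induction s using Finset.induction_on with
  | empty => simp
  | insert a s ha ih =>
    intro g hg
    by_cases h0 : g a = 0
    · rw [Finset.sum_insert ha, h0, map_zero, zero_mul, zero_add] at hg
      intro i hi
      rcases Finset.mem_insert.1 hi with rfl | hi
      · exact h0
      · exact ih g hg i hi
    · exfalso
      -- With the coefficient at `a` normalized to `1`, each `θ^(k)`, `k ≠ 0`, kills that term.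
      -- Induction applied to the remaining relation shows that all coefficients are constants,
      -- which `hlin` excludes.
      let g' : ι → E := fun i => (g a)⁻¹ * g i
      have hga : g' a = 1 := inv_mul_cancel₀ h0
      have hg' : ∑ i ∈ insert a s, algebraMap E R (g' i) * v i = 0 := by
        simp only [g', map_mul, mul_assoc, ← Finset.mul_sum, hg, mul_zero]
      have hconst : ∀ i ∈ insert a s, g' i ∈ θE.constants := by
        intro i hi
        rcases Finset.mem_insert.1 hi with rfl | hi
        · rw [hga]
          exact θE.constants.one_mem
        · rw [mem_constants_iff_comp]
          intro k hk
          refine ih (fun i => θE.comp k (g' i)) ?_ i hi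
          have h1 := congrArg (θR.comp k) hg'
          have h2 : θE.comp k (g' a) = 0 := by
            rw [hga]
            exact θE.mem_constants_iff_comp.1 θE.constants.one_mem k hk
          rw [comp_sum, comp_map_zero, Finset.sum_insert ha] at h1
          simp only [θR.comp_mul_of_mem_constants _ _ (hv _), h.map_comp] at h1
          rwa [h2, map_zero, zero_mul, zero_add] at h1
      have := hlin _ g' hconst hg' a (Finset.mem_insert_self a s)
      rw [hga] at this
      exact one_ne_zero this

end Hom

/-! ### Localizations, quotients and ID-simple rings. -/

section Constructions

variable {R : Type*} [CommRing R] (θ : IterativeDerivation m R)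

/-- The extension of `θ` to a localization, as a ring homomorphism. -/
noncomputable def localizationHom (M : Submonoid R) (S : Type*) [CommRing S] [Algebra R S]
    [IsLocalization M S] : S →+* MvPowerSeries (Fin m) S :=
  IsLocalization.lift (M := M) (g := (map (algebraMap R S)).comp θ.toHom) fun y => by
    -- A power series is a unit as soon as its constant coefficient is; here that coefficient is the
    -- image of `y`.
    rw [isUnit_iff_constantCoeff, RingHom.comp_apply, ← coeff_zero_eq_constantCoeff_apply,
      coeff_map, θ.coeff_zero]
    exact IsLocalization.map_units S y

theorem localizationHom_algebraMap (M : Submonoid R) (S : Type*) [CommRing S] [Algebra R S]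
    [IsLocalization M S] (r : R) :
    θ.localizationHom M S (algebraMap R S r) = map (algebraMap R S) (θ.toHom r) :=
  IsLocalization.lift_eq _ r

/-- The extension of an iterative derivation to a localization. -/
noncomputable def localization (M : Submonoid R) (S : Type*) [CommRing S] [Algebra R S]
    [IsLocalization M S] : IterativeDerivation m S :=
  ofRingHom (θ.localizationHom M S)
    (IsLocalization.ringHom_ext M <| RingHom.ext fun r => by
      rw [RingHom.comp_apply, RingHom.comp_apply, localizationHom_algebraMap,
        ← coeff_zero_eq_constantCoeff_apply, coeff_map, θ.coeff_zero]
      rfl)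
    (IsLocalization.ringHom_ext M <| RingHom.ext fun _ => by
      have h : (θ.localizationHom M S).comp (algebraMap R S) =
          (map (algebraMap R S)).comp θ.toHom :=
        RingHom.ext fun r => θ.localizationHom_algebraMap M S r
      simp only [RingHom.comp_apply, localizationHom_algebraMap]
      rw [taylor_map, ← map_toHom_toHom, map_map, map_map, h])

theorem isIDHom_localization (M : Submonoid R) (S : Type*) [CommRing S] [Algebra R S]
    [IsLocalization M S] : IsIDHom θ (θ.localization M S) (algebraMap R S) :=
  θ.localizationHom_algebraMap M S

/-- The iterative derivation on the quotient by an ID-ideal. -/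
noncomputable def quotient (I : Ideal R) (hI : θ.IsIDIdeal I) : IterativeDerivation m (R ⧸ I) where
  toHom := Ideal.Quotient.lift I ((map (Ideal.Quotient.mk I)).comp θ.toHom) fun r hr =>
    MvPowerSeries.ext fun k => by
      rw [RingHom.comp_apply, coeff_map, map_zero]
      exact Ideal.Quotient.eq_zero_iff_mem.2 (hI r hr k)
  coeff_zero r := by
    obtain ⟨r, rfl⟩ := Ideal.Quotient.mk_surjective r
    rw [Ideal.Quotient.lift_mk, RingHom.comp_apply, coeff_map, θ.coeff_zero]
  iterate i j r := by
    obtain ⟨r, rfl⟩ := Ideal.Quotient.mk_surjective r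
    simp only [Ideal.Quotient.lift_mk, RingHom.comp_apply, coeff_map, θ.iterate, map_nsmul]

theorem isIDHom_quotient (I : Ideal R) (hI : θ.IsIDIdeal I) :
    IsIDHom θ (θ.quotient I hI) (Ideal.Quotient.mk I) :=
  fun _ => rfl

/-- The largest ID-ideal inside an ideal. -/
noncomputable def core (J : Ideal R) : Ideal R :=
  RingHom.ker ((map (Ideal.Quotient.mk J)).comp θ.toHom)

variable {θ}

theorem mem_core {J : Ideal R} {r : R} : r ∈ θ.core J ↔ ∀ k, θ.comp k r ∈ J := by
  rw [core, RingHom.mem_ker, MvPowerSeries.ext_iff]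
  refine forall_congr' fun k => ?_
  rw [RingHom.comp_apply, coeff_map, map_zero, Ideal.Quotient.eq_zero_iff_mem]
  rfl

theorem core_le (J : Ideal R) : θ.core J ≤ J := fun r hr => by
  simpa [comp_zero_index] using mem_core.1 hr 0

theorem isIDIdeal_core (J : Ideal R) : θ.IsIDIdeal (θ.core J) := fun r hr k => by
  rw [mem_core] at hr ⊢
  intro i
  rw [comp_comp]
  exact nsmul_mem (hr _) _

/-- Stability under `θ` becomes an inequality of ideals, so it passes to suprema by monotonicity of
`core`. -/
theorem isIDIdeal_iff_le_core {I : Ideal R} : θ.IsIDIdeal I ↔ I ≤ θ.core I :=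
  ⟨fun h r hr => mem_core.2 (h r hr), fun h _ hr => mem_core.1 (h hr)⟩

theorem core_mono {I J : Ideal R} (h : I ≤ J) : θ.core I ≤ θ.core J := fun _ hr =>
  mem_core.2 fun k => h (mem_core.1 hr k)

theorem isIDIdeal_sSup {s : Set (Ideal R)} (hs : ∀ I ∈ s, θ.IsIDIdeal I) : θ.IsIDIdeal (sSup s) :=
  isIDIdeal_iff_le_core.2 <| sSup_le fun I hI =>
    (isIDIdeal_iff_le_core.1 (hs I hI)).trans (core_mono (le_sSup hI))

variable (θ) in
theorem exists_maximal_isIDIdeal [Nontrivial R] :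
    ∃ P : Ideal R, Maximal (fun I => θ.IsIDIdeal I ∧ I ≠ ⊤) P := by
  refine zorn_le₀ {I | θ.IsIDIdeal I ∧ I ≠ ⊤} fun c hc hchain => ?_
  refine ⟨sSup c, ⟨isIDIdeal_sSup fun I hI => (hc hI).1, ?_⟩, fun I hI => le_sSup hI⟩
  rcases c.eq_empty_or_nonempty with rfl | hne
  · rw [sSup_empty]
    exact bot_ne_top
  · rw [Ne, Ideal.eq_top_iff_one, Submodule.mem_sSup_of_directed hne hchain.directedOn]
    rintro ⟨I, hI, h1⟩
    exact (hc hI).2 ((Ideal.eq_top_iff_one I).2 h1)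

theorem isIDSimple_quotient {P : Ideal R} (hP : Maximal (fun I => θ.IsIDIdeal I ∧ I ≠ ⊤) P) :
    (θ.quotient P hP.prop.1).IsIDSimple := by
  refine ⟨Ideal.Quotient.nontrivial_iff.2 hP.prop.2, fun I hI => ?_⟩
  have hle : P ≤ I.comap (Ideal.Quotient.mk P) := by
    conv_lhs => rw [← Ideal.mk_ker (I := P)]
    exact Ideal.comap_mono bot_le
  have hID : θ.IsIDIdeal (I.comap (Ideal.Quotient.mk P)) := fun r hr k => by
    rw [Ideal.mem_comap] at hr ⊢
    rw [← (θ.isIDHom_quotient P hP.prop.1).map_comp]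
    exact hI _ hr k
  by_cases htop : I.comap (Ideal.Quotient.mk P) = ⊤
  · right
    rw [Ideal.comap_eq_top_iff] at htop
    exact htop
  · left
    have h := hP.le_of_ge ⟨hID, htop⟩ hle
    rw [eq_bot_iff]
    intro x hx
    obtain ⟨r, rfl⟩ := Ideal.Quotient.mk_surjective x
    exact Ideal.Quotient.eq_zero_iff_mem.2 (h hx)

/-- For a maximal ideal `J`, the ID-ideal `core J` is proper, hence zero. It is the kernel of `R →
(R ⧸ J)[[T]]`, so `R` embeds into a power series ring over a field. -/
theorem IsIDSimple.isDomain (h : θ.IsIDSimple) : IsDomain R := by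
  have := h.1
  obtain ⟨J, hJ⟩ := Ideal.exists_maximal R
  have hcore : θ.core J = ⊥ := (h.2 _ (isIDIdeal_core J)).resolve_right fun htop =>
    hJ.ne_top (eq_top_iff.2 (htop ▸ core_le J))
  have hJp := hJ.isPrime
  have : IsDomain (MvPowerSeries (Fin m) (R ⧸ J)) := NoZeroDivisors.to_isDomain _
  exact ((RingHom.injective_iff_ker_eq_bot _).2 hcore).isDomain _

/-- A constant generates an ID-ideal, so a nonzero constant is a unit, and its inverse is again
constant. -/
theorem IsIDSimple.isField_constants (h : θ.IsIDSimple) : IsField θ.constants := by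
  have := h.1
  refine ⟨⟨0, 1, zero_ne_one⟩, mul_comm, ?_⟩
  rintro ⟨c, hc⟩ h0
  have hI : θ.IsIDIdeal (Ideal.span {c}) := fun r hr k => by
    rw [Ideal.mem_span_singleton'] at hr ⊢
    obtain ⟨a, rfl⟩ := hr
    exact ⟨θ.comp k a, (θ.comp_mul_of_mem_constants k a hc).symm⟩
  rcases h.2 _ hI with hb | ht
  · exact (h0 (Subtype.ext (Ideal.span_singleton_eq_bot.1 hb))).elim
  · rw [Ideal.span_singleton_eq_top] at ht
    obtain ⟨d, hd⟩ := ht.exists_right_inv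
    exact ⟨⟨d, θ.inv_mem_constants hc hd⟩, Subtype.ext hd⟩

end Constructions

/-! ### Iterative differential equations and the generic solution. -/

section Equation

theorem IsIDE.coeff_zero {R : Type*} [CommRing R] {θ : IterativeDerivation m R} {n : ℕ}
    {A : Matrix (Fin n) (Fin n) (MvPowerSeries (Fin m) R)} (hA : θ.IsIDE A) (i j : Fin n) :
    coeff 0 (A i j) = (1 : Matrix (Fin n) (Fin n) R) i j :=
  congrFun (congrFun hA.2.1 i) j

theorem IsIDE.iterate {R : Type*} [CommRing R] {θ : IterativeDerivation m R} {n : ℕ}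
    {A : Matrix (Fin n) (Fin n) (MvPowerSeries (Fin m) R)} (hA : θ.IsIDE A)
    (k l : Fin m →₀ ℕ) (i j : Fin n) :
    multiBinom l k • coeff (k + l) (A i j) =
      ∑ p ∈ antidiagonal l, ∑ s, θ.comp p.1 (coeff k (A i s)) * coeff p.2 (A s j) := by
  have := congrFun (congrFun (hA.2.2 k l) i) j
  simpa [Matrix.sum_apply, Matrix.mul_apply] using this

/-- Invertibility of `A` is automatic: its determinant has constant coefficient `1`. -/
theorem isIDE_of_entries {R : Type*} [CommRing R] {θ : IterativeDerivation m R} {n : ℕ}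
    {A : Matrix (Fin n) (Fin n) (MvPowerSeries (Fin m) R)}
    (h0 : ∀ i j, coeff 0 (A i j) = (1 : Matrix (Fin n) (Fin n) R) i j)
    (h : ∀ k l i j, multiBinom l k • coeff (k + l) (A i j) =
      ∑ p ∈ antidiagonal l, ∑ s, θ.comp p.1 (coeff k (A i s)) * coeff p.2 (A s j)) :
    θ.IsIDE A := by
  have h0' : A.map (coeff 0) = 1 := Matrix.ext h0
  refine ⟨?_, h0', fun k l => Matrix.ext fun i j => ?_⟩
  · rw [Matrix.isUnit_iff_isUnit_det, isUnit_iff_constantCoeff, RingHom.map_det]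
    have h1 : (constantCoeff (σ := Fin m) (R := R)).mapMatrix A = 1 := h0'
    rw [h1, Matrix.det_one]
    exact isUnit_one
  · simpa [Matrix.sum_apply, Matrix.mul_apply] using h k l i j

theorem IsIDE.map {R S : Type*} [CommRing R] [CommRing S] {θR : IterativeDerivation m R}
    {θS : IterativeDerivation m S} {f : R →+* S} (hf : IsIDHom θR θS f) {n : ℕ}
    {A : Matrix (Fin n) (Fin n) (MvPowerSeries (Fin m) R)} (hA : θR.IsIDE A) :
    θS.IsIDE (A.map (MvPowerSeries.map f)) := by
  refine isIDE_of_entries (fun i j => ?_) fun k l i j => ?_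
  · rw [Matrix.map_apply, coeff_map, hA.coeff_zero]
    simp [Matrix.one_apply, apply_ite f]
  · have := congrArg f (hA.iterate k l i j)
    simpa [coeff_map, hf.map_comp] using this

/-- The matrix expressing the iterative derivation of a finite extension in a basis is an
iterative differential equation. -/
theorem exists_isIDE_of_basis {F E : Type*} [Field F] [CommRing E] [Algebra F E]
    {θF : IterativeDerivation m F} {θE : IterativeDerivation m E}
    (h : IsIDHom θF θE (algebraMap F E)) {n : ℕ} (b : Module.Basis (Fin n) F E) :
    ∃ A : Matrix (Fin n) (Fin n) (MvPowerSeries (Fin m) F), θF.IsIDE A ∧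
      ∀ k i, θE.comp k (b i) = ∑ j, algebraMap F E (coeff k (A i j)) * b j := by
  classical
  obtain ⟨A, hcoeff⟩ : ∃ A : Matrix (Fin n) (Fin n) (MvPowerSeries (Fin m) F),
      ∀ k i j, coeff k (A i j) = b.repr (θE.comp k (b i)) j :=
    ⟨fun i j k => b.repr (θE.comp k (b i)) j, fun _ _ _ => rfl⟩
  have hA : ∀ k i, θE.comp k (b i) = ∑ j, algebraMap F E (coeff k (A i j)) * b j := fun k i => by
    simp_rw [← Algebra.smul_def, hcoeff]
    exact (b.sum_repr _).symm
  refine ⟨A, isIDE_of_entries (fun i j => ?_) fun k l i => ?_, hA⟩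
  · rw [hcoeff, comp_zero_index, b.repr_self, Matrix.one_apply, Finsupp.single_apply]
  -- Both sides are the coordinates of `θ^(l)(θ^(k)(b i))`, computed by the iteration rule and by
  -- the product rule.
  · refine congrFun (b.equivFun.symm.injective ?_)
    rw [b.equivFun_symm_apply, b.equivFun_symm_apply]
    calc ∑ j, (multiBinom l k • coeff (k + l) (A i j)) • b j
        = multiBinom l k • θE.comp (l + k) (b i) := by
          rw [add_comm l k, hA, Finset.smul_sum]
          refine Finset.sum_congr rfl fun j _ => ?_
          rw [smul_assoc, ← Algebra.smul_def (R := F)]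
      _ = ∑ s, ∑ p ∈ antidiagonal l, ∑ j,
            algebraMap F E (θF.comp p.1 (coeff k (A i s)) * coeff p.2 (A s j)) * b j := by
          rw [← comp_comp, hA, comp_sum]
          refine Finset.sum_congr rfl fun s _ => ?_
          rw [comp_mul]
          refine Finset.sum_congr rfl fun p _ => ?_
          rw [h.map_comp, hA, Finset.mul_sum]
          simp_rw [map_mul, mul_assoc]
      _ = ∑ j, (∑ p ∈ antidiagonal l, ∑ s,
            θF.comp p.1 (coeff k (A i s)) * coeff p.2 (A s j)) • b j := by
          simp_rw [Algebra.smul_def, map_sum, Finset.sum_mul]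
          rw [Finset.sum_comm]
          conv_rhs => rw [Finset.sum_comm]
          refine Finset.sum_congr rfl fun p _ => ?_
          rw [Finset.sum_comm]

variable {R : Type*} [CommRing R] {θ : IterativeDerivation m R} {n : ℕ}
  {A : Matrix (Fin n) (Fin n) (MvPowerSeries (Fin m) R)}

/-- The homomorphism on `R[X_ij]` that extends `θ` by `X ↦ A X`. -/
noncomputable def universalHom (θ : IterativeDerivation m R)
    (A : Matrix (Fin n) (Fin n) (MvPowerSeries (Fin m) R)) :
    MvPolynomial (Fin n × Fin n) R →+* MvPowerSeries (Fin m) (MvPolynomial (Fin n × Fin n) R) :=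
  MvPolynomial.eval₂Hom ((MvPowerSeries.map MvPolynomial.C).comp θ.toHom) fun ij =>
    ∑ s, MvPowerSeries.map MvPolynomial.C (A ij.1 s) * C (MvPolynomial.X (s, ij.2))

theorem universalHom_C (r : R) :
    universalHom θ A (MvPolynomial.C r) = MvPowerSeries.map MvPolynomial.C (θ.toHom r) :=
  MvPolynomial.eval₂Hom_C _ _ _

theorem universalHom_X (i j : Fin n) :
    universalHom θ A (MvPolynomial.X (i, j)) =
      ∑ s, MvPowerSeries.map MvPolynomial.C (A i s) * C (MvPolynomial.X (s, j)) :=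
  MvPolynomial.eval₂Hom_X' _ _ _

theorem coeff_universalHom_X (k : Fin m →₀ ℕ) (i j : Fin n) :
    coeff k (universalHom θ A (MvPolynomial.X (i, j))) =
      ∑ s, MvPolynomial.C (coeff k (A i s)) * MvPolynomial.X (s, j) := by
  rw [universalHom_X, map_sum]
  simp_rw [coeff_mul_C, coeff_map]

/-- The iterative derivation on `R[X_ij]` with `θ(X) = A X`. -/
noncomputable def universal (hA : θ.IsIDE A) :
    IterativeDerivation m (MvPolynomial (Fin n × Fin n) R) :=
  ofRingHom (universalHom θ A)
    (MvPolynomial.ringHom_ext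
      (fun r => by
        rw [RingHom.comp_apply, universalHom_C, ← coeff_zero_eq_constantCoeff_apply, coeff_map,
          θ.coeff_zero]
        rfl)
      fun ij => by
        rw [RingHom.comp_apply, ← coeff_zero_eq_constantCoeff_apply, coeff_universalHom_X]
        simp [hA.coeff_zero, Matrix.one_apply])
    (MvPolynomial.ringHom_ext
      (fun r => by
        have h : (universalHom θ A).comp MvPolynomial.C =
            (MvPowerSeries.map MvPolynomial.C).comp θ.toHom :=
          RingHom.ext fun r => universalHom_C r
        rw [RingHom.comp_apply, RingHom.comp_apply, universalHom_C, taylor_map,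
          ← map_toHom_toHom, map_map, map_map, h])
      fun ij => by
        classical
        -- On the variables, the Taylor identity amounts to the compatibility condition
        -- `hA.iterate`.
        refine MvPowerSeries.ext fun k => MvPowerSeries.ext fun l => ?_
        rw [RingHom.comp_apply, RingHom.comp_apply, coeff_map, coeff_coeff_taylor,
          coeff_universalHom_X, coeff_universalHom_X, map_sum, map_sum]
        simp_rw [map_mul, coeff_mul, universalHom_C, coeff_map, coeff_universalHom_X]
        rw [Finset.smul_sum]
        have h : ∀ t, multiBinom l k • (MvPolynomial.C (coeff (l + k) (A ij.1 t)) *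
            MvPolynomial.X (t, ij.2)) = (∑ p ∈ antidiagonal l, ∑ s,
              MvPolynomial.C (θ.comp p.1 (coeff k (A ij.1 s)) * coeff p.2 (A s t))) *
                (MvPolynomial.X (t, ij.2) : MvPolynomial (Fin n × Fin n) R) := fun t => by
          rw [← smul_mul_assoc, ← map_nsmul, add_comm l k, hA.iterate, map_sum]
          simp_rw [map_sum]
        simp_rw [h, Finset.sum_mul, Finset.mul_sum]
        rw [Finset.sum_comm]
        conv_rhs => rw [Finset.sum_comm]
        refine Finset.sum_congr rfl fun p _ => ?_
        rw [Finset.sum_comm]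
        refine Finset.sum_congr rfl fun t _ => Finset.sum_congr rfl fun s _ => ?_
        rw [MvPolynomial.C_mul, mul_assoc]
        rfl)

theorem isIDHom_universal (hA : θ.IsIDE A) : IsIDHom θ (universal hA) MvPolynomial.C :=
  fun r => universalHom_C r

end Equation

/-! ### ID-simple solution rings and comparison of solutions. -/

section Solution

variable {n : ℕ}

/-- Every iterative differential equation over an ID-field has an ID-simple ring generated by a
fundamental solution matrix. -/
theorem exists_idSimple_generated {E : Type v} [Field E] {θE : IterativeDerivation m E}
    {A : Matrix (Fin n) (Fin n) (MvPowerSeries (Fin m) E)} (hA : θE.IsIDE A) :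
    ∃ (R : Type v) (_ : CommRing R) (_ : Algebra E R) (θR : IterativeDerivation m R)
      (Y : GL (Fin n) R), IsIDHom θE θR (algebraMap E R) ∧ θR.IsIDSimple ∧
      IsFundamentalSolution θR A Y ∧
      Algebra.adjoin E
        (Set.range (fun ij : Fin n × Fin n => (Y : Matrix (Fin n) (Fin n) R) ij.1 ij.2) ∪
          {((Matrix.GeneralLinearGroup.det Y)⁻¹ : Rˣ).val}) = ⊤ := by
  let X := Matrix.mvPolynomialX (Fin n) (Fin n) E
  let U := Localization.Away X.det
  have hX : X.det ≠ 0 := Matrix.det_mvPolynomialX_ne_zero (Fin n) E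
  have hU : IsDomain U :=
    IsLocalization.isDomain_localization (powers_le_nonZeroDivisors_of_noZeroDivisors hX)
  let θU : IterativeDerivation m U := (universal hA).localization (Submonoid.powers X.det) U
  obtain ⟨P, hP⟩ := θU.exists_maximal_isIDIdeal
  let g : MvPolynomial (Fin n × Fin n) E →ₐ[E] U ⧸ P :=
    (Ideal.Quotient.mkₐ E P).comp (Algebra.algHom E _ U)
  have hgapp : ∀ p, g p = Ideal.Quotient.mk P (algebraMap _ U p) := fun _ => rfl
  let θR := θU.quotient P hP.prop.1
  have hgID : IsIDHom (universal hA) θR g.toRingHom :=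
    (θU.isIDHom_quotient P hP.prop.1).trans
      ((universal hA).isIDHom_localization (Submonoid.powers X.det) U)
  have hdet : IsUnit (X.map g).det := by
    have h1 : (X.map g).det = g X.det := (RingHom.map_det g.toRingHom X).symm
    rw [h1, hgapp]
    exact (IsLocalization.Away.algebraMap_isUnit X.det).map _
  let Y : GL (Fin n) (U ⧸ P) := Matrix.GeneralLinearGroup.mk'' (X.map g) hdet
  have hY : (Y : Matrix (Fin n) (Fin n) (U ⧸ P)) = X.map g := rfl
  have hEg : g.toRingHom.comp MvPolynomial.C = algebraMap E (U ⧸ P) :=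
    RingHom.ext fun r => g.commutes r
  refine ⟨U ⧸ P, inferInstance, inferInstance, θR, Y, ?_, isIDSimple_quotient hP, ?_, ?_⟩
  · rw [← hEg]
    exact hgID.trans (isIDHom_universal hA)
  · refine Matrix.ext fun i j => ?_
    rw [hY, Matrix.map_apply, Matrix.map_apply, Matrix.mul_apply]
    change θR.toHom (g.toRingHom (X i j)) = _
    rw [hgID]
    change MvPowerSeries.map g.toRingHom (universalHom θE A (MvPolynomial.X (i, j))) = _
    rw [universalHom_X, map_sum]
    refine Finset.sum_congr rfl fun s _ => ?_
    rw [map_mul, map_map, hEg, map_C]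
    rfl
  · set S := Algebra.adjoin E
        (Set.range (fun ij : Fin n × Fin n => (Y : Matrix (Fin n) (Fin n) (U ⧸ P)) ij.1 ij.2) ∪
          {((Matrix.GeneralLinearGroup.det Y)⁻¹ : (U ⧸ P)ˣ).val}) with hS
    have hgS : ∀ p, g p ∈ S := fun p => by
      induction p using MvPolynomial.induction_on with
      | C r => exact (g.commutes r).symm ▸ S.algebraMap_mem r
      | add p q hp hq => exact (map_add g p q).symm ▸ S.add_mem hp hq
      | mul_X p ij hp =>
        rw [map_mul]
        exact S.mul_mem hp (Algebra.subset_adjoin (Or.inl ⟨ij, rfl⟩))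
    have hinv : ((Matrix.GeneralLinearGroup.det Y)⁻¹ : (U ⧸ P)ˣ).val ∈ S :=
      Algebra.subset_adjoin (Or.inr rfl)
    have hdetY : (Matrix.GeneralLinearGroup.det Y : (U ⧸ P)ˣ).val = g X.det :=
      (RingHom.map_det g.toRingHom X).symm
    rw [eq_top_iff]
    rintro z -
    -- Every element comes from a fraction with denominator a power of `det X`, and `(det Y)⁻¹` is
    -- among the generators.
    obtain ⟨z, rfl⟩ := Ideal.Quotient.mk_surjective z
    obtain ⟨k, a, ha⟩ := IsLocalization.Away.surj X.det z
    have h1 := congrArg (Ideal.Quotient.mk P) ha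
    rw [map_mul, map_pow, ← hgapp, ← hgapp, ← hdetY, ← Units.val_pow_eq_pow_val,
      ← Units.eq_mul_inv_iff_mul_eq, ← inv_pow, Units.val_pow_eq_pow_val] at h1
    rw [h1]
    exact S.mul_mem (hgS a) (S.pow_mem hinv k)

/-- Two vector solutions of the same equation, one of them fundamental, differ by a constant
vector. -/
theorem exists_eq_mulVec_constants {R : Type*} [CommRing R] {θ : IterativeDerivation m R}
    {B : Matrix (Fin n) (Fin n) (MvPowerSeries (Fin m) R)} (Y : GL (Fin n) R)
    (hY : (Y : Matrix (Fin n) (Fin n) R).map θ.toHom = B * (Y : Matrix (Fin n) (Fin n) R).map C)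
    (e : Fin n → R) (he : θ.toHom ∘ e = B.mulVec (C ∘ e)) :
    ∃ v : Fin n → R, (∀ i, v i ∈ θ.constants) ∧ e = (Y : Matrix (Fin n) (Fin n) R).mulVec v := by
  let v := ((Y⁻¹ : GL (Fin n) R) : Matrix (Fin n) (Fin n) R).mulVec e
  have hv : e = (Y : Matrix (Fin n) (Fin n) R).mulVec v := by
    rw [Matrix.mulVec_mulVec, ← Units.val_mul, mul_inv_cancel, Units.val_one, Matrix.one_mulVec]
  refine ⟨v, ?_, hv⟩
  have hmap : ∀ f : R →+* MvPowerSeries (Fin m) R,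
      f ∘ e = ((Y : Matrix (Fin n) (Fin n) R).map f).mulVec (f ∘ v) := fun f => by
    funext i
    conv_lhs => rw [hv]
    exact RingHom.map_mulVec f _ _ i
  -- With `e = Y v`, one gets `θ(Y) θ(v) = θ(e) = B e = B Y v = θ(Y) v`; cancelling `θ(Y)` gives
  -- `θ(v) = v`.
  have h1 : ((Y : Matrix (Fin n) (Fin n) R).map θ.toHom).mulVec (θ.toHom ∘ v) =
      ((Y : Matrix (Fin n) (Fin n) R).map θ.toHom).mulVec (C ∘ v) := by
    rw [← hmap, he, hmap, hY, Matrix.mulVec_mulVec]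
  have hu : IsUnit ((Y : Matrix (Fin n) (Fin n) R).map θ.toHom) :=
    Y.isUnit.map (RingHom.mapMatrix θ.toHom)
  exact fun i => congrFun (Matrix.mulVec_injective_of_isUnit hu h1) i

end Solution

/-! ### Linear disjointness from constants and the map `F ⊗ L → R`. -/

section BaseChange

variable {F : Type u} [Field F] {θF : IterativeDerivation m F} {R : Type v} [CommRing R]
  [Algebra F R] {θR : IterativeDerivation m R} {L : Type w} [Field L]
  [Algebra θF.constantField L]

/-- A field of constants of an ID-ring over an ID-field `E` without new constants is linearly
disjoint from `E`. -/
theorem linearIndependent_comp_of_constants [Nontrivial R] {E : Type*} [Field E] [Algebra F E]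
    [Algebra E R] [IsScalarTower F E R] {θE : IterativeDerivation m E}
    (hER : IsIDHom θE θR (algebraMap E R))
    (hconst : θE.constants = θF.constants.map (algebraMap F E))
    (f : L →ₐ[θF.constantField] R) (hf : ∀ l, f l ∈ θR.constants) {ι : Type*} {w : ι → L}
    (hw : LinearIndependent θF.constantField w) : LinearIndependent E (f ∘ w) := by
  classical
  refine linearIndependent_of_constants hER (fun i => hf (w i)) fun s g hg hsum => ?_
  -- Constant coefficients in `E` come from `K`, so the relation descends to one over `K` inside
  -- `L`.
  have hx : ∀ i, ∃ x : θF.constantField, i ∈ s → algebraMap F E x = g i := fun i => by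
    by_cases hi : i ∈ s
    · have h := hg i hi
      rw [hconst] at h
      obtain ⟨x, hx, hxg⟩ := h
      exact ⟨⟨x, hx⟩, fun _ => hxg⟩
    · exact ⟨0, fun h => (hi h).elim⟩
  choose x hx using hx
  have hsum' : ∑ i ∈ s, x i • w i = 0 := by
    refine (RingHom.injective f.toRingHom) ?_
    rw [map_zero, ← hsum, map_sum]
    refine Finset.sum_congr rfl fun i hi => ?_
    rw [← hx i hi, ← IsScalarTower.algebraMap_apply]
    change f (x i • w i) = _
    rw [map_smul, Algebra.smul_def]
    rfl
  intro i hi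
  rw [← hx i hi, linearIndependent_iff'.1 hw s x hsum' i hi]
  exact map_zero _

/-- The multiplication map `F ⊗ L → R`. -/
noncomputable def mulMap (f : L →ₐ[θF.constantField] R) : F ⊗[θF.constantField] L →ₐ[F] R :=
  Algebra.TensorProduct.lift (Algebra.ofId F R) f fun _ _ => Commute.all _ _

theorem mulMap_tmul (f : L →ₐ[θF.constantField] R) (x : F) (l : L) :
    mulMap f (x ⊗ₜ l) = algebraMap F R x * f l :=
  Algebra.TensorProduct.lift_tmul _ _ _ _ _

/-- A `K`-basis of `L` is an `F`-basis of `F ⊗ L`, and its image in `R` consists of constants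
independent over `F`. -/
theorem mulMap_injective [Nontrivial R] (hFR : IsIDHom θF θR (algebraMap F R))
    (f : L →ₐ[θF.constantField] R) (hf : ∀ l, f l ∈ θR.constants) :
    Function.Injective (mulMap f) := by
  let b := Module.Basis.ofVectorSpace θF.constantField L
  have hli : LinearIndependent F (f ∘ b) :=
    linearIndependent_comp_of_constants (θE := θF) hFR
      (by rw [Algebra.algebraMap_self, Subring.map_id]) f hf b.linearIndependent
  let B := Algebra.TensorProduct.basis F b
  have hcomp : (mulMap f).toLinearMap ∘ₗ B.repr.symm.toLinearMap =
      Finsupp.linearCombination F (f ∘ b) := by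
    refine Finsupp.lhom_ext' fun i => LinearMap.ext_ring ?_
    simp [B, mulMap_tmul]
  have hinj : Function.Injective ((mulMap f).toLinearMap ∘ₗ B.repr.symm.toLinearMap) := by
    rw [hcomp]
    exact hli
  intro x y hxy
  refine B.repr.injective (hinj ?_)
  simpa using hxy

theorem isIDHom_mulMap (hFR : IsIDHom θF θR (algebraMap F R))
    (f : L →ₐ[θF.constantField] R) (hf : ∀ l, f l ∈ θR.constants) :
    IsIDHom (θF.baseChange L) θR (mulMap f).toRingHom := by
  refine isIDHom_iff.2 fun k z => ?_
  induction z using TensorProduct.induction_on with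
  | zero => simp [comp_map_zero]
  | tmul x l =>
    have h : (θF.baseChange L).comp k (x ⊗ₜ l) = θF.comp k x ⊗ₜ l :=
      coeff_tensorHom_tmul θF L k x l
    rw [h]
    change θR.comp k (mulMap f (x ⊗ₜ l)) = mulMap f (θF.comp k x ⊗ₜ l)
    rw [mulMap_tmul, mulMap_tmul, comp_mul_of_mem_constants _ _ _ (hf l), hFR.map_comp]
  | add a b ha hb => rw [map_add, comp_add, comp_add, map_add, ha, hb]

theorem isIDHom_includeLeft :
    IsIDHom θF (θF.baseChange L) (algebraMap F (F ⊗[θF.constantField] L)) :=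
  isIDHom_iff.2 fun k x => coeff_tensorHom_tmul θF L k x 1

theorem one_tmul_mem_constants (l : L) :
    (1 : F) ⊗ₜ[θF.constantField] l ∈ (θF.baseChange L).constants := by
  rw [mem_constants_iff_comp]
  intro k hk
  have h : (θF.baseChange L).comp k (1 ⊗ₜ l) = θF.comp k 1 ⊗ₜ l :=
    coeff_tensorHom_tmul θF L k 1 l
  rw [h, θF.mem_constants_iff_comp.1 θF.constants.one_mem k hk, TensorProduct.zero_tmul]

end BaseChange

/-! ### The PPV-ring over `FL` and the conclusion. -/

/-- The solution ring over `E` of the equation satisfied by a basis of `E` over `F` is a PPV-ring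
over `F ⊗ L`, where `L` is its field of constants. -/
theorem isPPVRing_of_basis {F : Type u} {E R : Type v} [Field F] [Field E] [Algebra F E]
    [CommRing R] [Algebra F R] [Algebra E R] [IsScalarTower F E R]
    {θF : IterativeDerivation m F} {θE : IterativeDerivation m E} {θR : IterativeDerivation m R}
    {L : Type v} [Field L] [Algebra θF.constantField L]
    (hFE : IsIDHom θF θE (algebraMap F E)) (hER : IsIDHom θE θR (algebraMap E R))
    (hsimple : θR.IsIDSimple) (f : L →ₐ[θF.constantField] R)
    (hf : ∀ r, r ∈ θR.constants ↔ ∃ l, f l = r) {n : ℕ} (b : Module.Basis (Fin n) F E)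
    {A : Matrix (Fin n) (Fin n) (MvPowerSeries (Fin m) F)}
    (hAb : ∀ k i, θE.comp k (b i) = ∑ j, algebraMap F E (coeff k (A i j)) * b j)
    {Y : GL (Fin n) R} (hsol : IsFundamentalSolution θR A Y)
    (hgen : Algebra.adjoin E
        (Set.range (fun ij : Fin n × Fin n => (Y : Matrix (Fin n) (Fin n) R) ij.1 ij.2) ∪
          {((Matrix.GeneralLinearGroup.det Y)⁻¹ : Rˣ).val}) = ⊤) :
    letI : Algebra (F ⊗[θF.constantField] L) R := (mulMap f).toRingHom.toAlgebra
    IsPPVRing (θF.baseChange L) θR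
      (A.map (MvPowerSeries.map (algebraMap F (F ⊗[θF.constantField] L)))) := by
  let _ : Algebra (F ⊗[θF.constantField] L) R := (mulMap f).toRingHom.toAlgebra
  have hfc : ∀ l, f l ∈ θR.constants := fun l => (hf _).2 ⟨l, rfl⟩
  have hFR : IsIDHom θF θR (algebraMap F R) := by
    rw [IsScalarTower.algebraMap_eq F E R]
    exact hER.trans hFE
  have hmap : algebraMap (F ⊗[θF.constantField] L) R = (mulMap f).toRingHom := rfl
  have hleft : (algebraMap (F ⊗[θF.constantField] L) R).comp
      (algebraMap F (F ⊗[θF.constantField] L)) = algebraMap F R :=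
    RingHom.ext fun x => (mulMap f).commutes x
  have hright : ∀ l, algebraMap (F ⊗[θF.constantField] L) R (1 ⊗ₜ l) = f l := fun l => by
    change mulMap f (1 ⊗ₜ l) = f l
    rw [mulMap_tmul, map_one, one_mul]
  refine ⟨isIDHom_mulMap hFR f hfc, hsimple, ⟨Y, ?_, ?_⟩, ?_⟩
  · rw [IsFundamentalSolution] at hsol ⊢
    rw [hsol, Matrix.map_map, ← RingHom.coe_comp, ← MvPowerSeries.map_comp, hleft]
  · set S := Algebra.adjoin (F ⊗[θF.constantField] L)
        (Set.range (fun ij : Fin n × Fin n => (Y : Matrix (Fin n) (Fin n) R) ij.1 ij.2) ∪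
          {((Matrix.GeneralLinearGroup.det Y)⁻¹ : Rˣ).val}) with hS
    have hFS : ∀ x : F, algebraMap F R x ∈ S := fun x => by
      rw [← hleft]
      exact S.algebraMap_mem (algebraMap F _ x)
    -- The basis `b` solves the same equation as `Y`, so `b = Y v` with `v` constant, hence with
    -- entries in the image of `L`. This puts `E` inside `S`, and generation over `E` becomes
    -- generation over `F ⊗ L`.
    obtain ⟨v, hv, hbv⟩ := exists_eq_mulVec_constants Y hsol (fun i => algebraMap E R (b i)) <| by
      funext i
      refine MvPowerSeries.ext fun k => ?_
      rw [Matrix.mulVec, dotProduct]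
      change θR.comp k (algebraMap E R (b i)) = _
      rw [hER.map_comp, hAb, map_sum, map_sum]
      refine Finset.sum_congr rfl fun j _ => ?_
      rw [Function.comp_apply, coeff_mul_C, Matrix.map_apply, coeff_map, map_mul,
        ← IsScalarTower.algebraMap_apply]
    have hvS : ∀ i, v i ∈ S := fun i => by
      obtain ⟨l, hl⟩ := (hf _).1 (hv i)
      rw [← hl, ← hright]
      exact S.algebraMap_mem _
    have hES : ∀ x : E, algebraMap E R x ∈ S := fun x => by
      rw [← b.sum_repr x, map_sum]
      refine S.sum_mem fun i _ => ?_
      rw [Algebra.smul_def, map_mul, ← IsScalarTower.algebraMap_apply]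
      refine S.mul_mem (hFS _) ?_
      have := congrFun hbv i
      rw [Matrix.mulVec, dotProduct] at this
      rw [this]
      exact S.sum_mem fun j _ =>
        S.mul_mem (Algebra.subset_adjoin (Or.inl ⟨(i, j), rfl⟩)) (hvS j)
    rw [eq_top_iff]
    rintro z -
    have hz : z ∈ (⊤ : Subalgebra E R) := Algebra.mem_top
    rw [← hgen] at hz
    induction hz using Algebra.adjoin_induction with
    | mem x hx => exact Algebra.subset_adjoin hx
    | algebraMap x => exact hES x
    | add x y _ _ hx hy => exact S.add_mem hx hy
    | mul x y _ _ hx hy => exact S.mul_mem hx hy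
  -- The constants of `F ⊗ L` need not be computed: they map to constants of `R`, which come from
  -- `L`, and every `1 ⊗ l` is constant.
  · ext r
    rw [hf, Subring.mem_map]
    constructor
    · rintro ⟨l, rfl⟩
      exact ⟨_, one_tmul_mem_constants l, hright l⟩
    · rintro ⟨z, hz, rfl⟩
      exact (hf _).1 ((isIDHom_mulMap hFR f hfc).map_mem_constants hz)

/-- If `L` is the field of constants of the solution ring of the equation satisfied by a basis of
`E` over `F`, then `F ⊗ L` is a field and `E` embeds into a PPV-field over it. -/
theorem exists_isPPVField_of_basis {m : ℕ} {F : Type u} {E R : Type v} [Field F] [Field E] [Algebra F E]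
    [CommRing R] [Algebra F R] [Algebra E R] [IsScalarTower F E R]
    {θF : IterativeDerivation m F} {θE : IterativeDerivation m E} {θR : IterativeDerivation m R}
    {L : Type v} [Field L] [Algebra θF.constantField L]
    (hFE : IsIDHom θF θE (algebraMap F E)) (hER : IsIDHom θE θR (algebraMap E R))
    (hconst : θE.constants = θF.constants.map (algebraMap F E))
    (hsimple : θR.IsIDSimple) (f : L →ₐ[θF.constantField] R)
    (hf : ∀ r, r ∈ θR.constants ↔ ∃ l, f l = r) {n : ℕ} (b : Module.Basis (Fin n) F E)
    {A : Matrix (Fin n) (Fin n) (MvPowerSeries (Fin m) F)} (hA : θF.IsIDE A)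
    (hAb : ∀ k i, θE.comp k (b i) = ∑ j, algebraMap F E (MvPowerSeries.coeff k (A i j)) * b j)
    {Y : GL (Fin n) R} (hsol : IsFundamentalSolution θR A Y)
    (hgen : Algebra.adjoin E
        (Set.range (fun ij : Fin n × Fin n => (Y : Matrix (Fin n) (Fin n) R) ij.1 ij.2) ∪
          {((Matrix.GeneralLinearGroup.det Y)⁻¹ : Rˣ).val}) = ⊤) :
    FiniteDimensional θF.constantField L ∧ IsField (F ⊗[θF.constantField] L) ∧
      ∃ (M : Type v) (_ : Field M) (_ : Algebra (F ⊗[θF.constantField] L) M)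
        (θM : IterativeDerivation m M), IsPPVField (θF.baseChange L) θM ∧
        ∃ ι : E →+* M, IsIDHom θE θM ι ∧
          ∀ x : F, ι (algebraMap F E x) =
            algebraMap (F ⊗[θF.constantField] L) M (x ⊗ₜ[θF.constantField] (1 : L)) := by
  have hdom := hsimple.isDomain
  have hfc : ∀ l, f l ∈ θR.constants := fun l => (hf _).2 ⟨l, rfl⟩
  have hFR : IsIDHom θF θR (algebraMap F R) := by
    rw [IsScalarTower.algebraMap_eq F E R]
    exact hER.trans hFE
  have hft : Algebra.FiniteType E R :=
    ⟨⟨(((Set.finite_range _).union (Set.finite_singleton _)).toFinset), by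
      rw [Set.Finite.coe_toFinset]
      exact hgen⟩⟩
  have hKER : IsScalarTower θF.constantField E R :=
    .of_algebraMap_eq fun x => IsScalarTower.algebraMap_apply F E R x
  have hfin : FiniteDimensional θF.constantField L :=
    finiteDimensional_of_linearIndependent (E := E) f fun _ _ hw =>
      linearIndependent_comp_of_constants hER hconst f hfc hw
  have hTdom : IsDomain (F ⊗[θF.constantField] L) :=
    (mulMap_injective hFR f hfc).isDomain (mulMap f).toRingHom
  let _ : Algebra (F ⊗[θF.constantField] L) R := (mulMap f).toRingHom.toAlgebra
  -- `F ⊗ L` is a domain by injectivity into `R`, and it is integral over `F` because `L` is finite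
  -- over `K`.
  refine ⟨hfin, isField_of_isIntegral_of_isField' (Field.toIsField F), FractionRing R,
    inferInstance, inferInstance, θR.localization (nonZeroDivisors R) (FractionRing R),
    ⟨n, _, hA.map isIDHom_includeLeft, R, inferInstance, inferInstance, inferInstance,
      inferInstance, θR, isPPVRing_of_basis hFE hER hsimple f hf b hAb hsol hgen, inferInstance,
      θR.isIDHom_localization _ _⟩,
    (algebraMap R (FractionRing R)).comp (algebraMap E R),
    (θR.isIDHom_localization _ _).trans hER, fun x => ?_⟩
  rw [IsScalarTower.algebraMap_apply (F ⊗[θF.constantField] L) R (FractionRing R),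
    RingHom.comp_apply, ← IsScalarTower.algebraMap_apply F E R]
  exact congrArg _ ((mulMap f).commutes x).symm

end IterativeDerivation

theorem mainTheorem7 {m : ℕ} {F : Type u} {E : Type v} [Field F] [Field E] [Algebra F E]
    (θF : IterativeDerivation m F) (θE : IterativeDerivation m E)
    (hFE : IterativeDerivation.IsIDHom θF θE (algebraMap F E))
    (hfin : FiniteDimensional F E)
    (hconst : θE.constants = θF.constants.map (algebraMap F E)) :
    ∃ (L : Type v) (_ : Field L) (_ : Algebra θF.constantField L),
      FiniteDimensional θF.constantField L ∧
      IsField (F ⊗[θF.constantField] L) ∧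
      ∃ (M : Type v) (_ : Field M) (_ : Algebra (F ⊗[θF.constantField] L) M)
        (θM : IterativeDerivation m M),
        IterativeDerivation.IsPPVField (θF.baseChange L) θM ∧
        ∃ ι : E →+* M, IterativeDerivation.IsIDHom θE θM ι ∧
          ∀ x : F, ι (algebraMap F E x) =
            algebraMap (F ⊗[θF.constantField] L) M (x ⊗ₜ[θF.constantField] (1 : L)) := by
  have b := Module.finBasis F E
  obtain ⟨A, hA, hAb⟩ := IterativeDerivation.exists_isIDE_of_basis hFE b
  -- The equation over `F` is solved over `E`, so that `R` contains `E` from the start; `L` is then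
  -- its field of constants.
  obtain ⟨R, _, _, θR, Y, hER, hsimple, hsol, hgen⟩ := IterativeDerivation.exists_idSimple_generated (hA.map hFE)
  let _ : Algebra F R := ((algebraMap E R).comp (algebraMap F E)).toAlgebra
  have htower : IsScalarTower F E R := .of_algebraMap_eq fun _ => rfl
  let _ : Field θR.constants := hsimple.isField_constants.toField
  let _ : Algebra θF.constantField θR.constants :=
    (RingHom.codRestrict ((algebraMap F R).comp θF.constantField.subtype) θR.constants
      fun x => (hER.trans hFE).map_mem_constants x.2).toAlgebra
  let f : θR.constants →ₐ[θF.constantField] R :=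
    { θR.constants.subtype with commutes' := fun _ => rfl }
  have hsol' : IterativeDerivation.IsFundamentalSolution θR A Y := by
    rw [IterativeDerivation.IsFundamentalSolution] at hsol ⊢
    rw [hsol, Matrix.map_map, ← RingHom.coe_comp, ← MvPowerSeries.map_comp,
      ← IsScalarTower.algebraMap_eq]
  exact ⟨θR.constants, inferInstance, inferInstance,
    IterativeDerivation.exists_isPPVField_of_basis hFE hER hconst hsimple f
      (fun r => ⟨fun hr => ⟨⟨r, hr⟩, rfl⟩, fun ⟨l, hl⟩ => hl ▸ l.2⟩) b hA hAb hsol' hgen⟩
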